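/- Let $d\ge 0$, $n\ge 1$, $\gamma>0$, $m,L,\nu>0$ and $\theta^*\in\mathbb{R}^d$. Let $p(x|\theta)$, $x\in\mathbb{R}$, $\theta\in\mathbb{R}^d$, be a family of strictly positive probability densities on $\mathbb{R}$ such that $\theta\mapsto\log p(x|\theta)$ is concave for every $x$, and let $\pi$ be a strictly positive probability density on $\mathbb{R}^d$ (the prior). Assume: 1. for every $x\in\mathbb{R}$, $\log p(x|\cdot)$ is differentiable at $\theta^*$, and for all $x\in\mathbb{R}$, $\theta\in\mathbb{R}^d$, $$\tfrac m2\|\theta-\theta^*\|^2\;\le\;-\log p(x|\theta)+\log p(x|\theta^*)+\nabla_\theta\log p(x|\theta^*)^\top(\theta-\theta^*)\;\le\;\tfrac L2\|\theta-\theta^*\|^2;$$ 2. $x\mapsto\log p(x|\theta^*)$ is differentiable and $\nu$-strongly concave, i.e. $-\big(\partial_x\log p(x|\theta^*)-\partial_x\log p(x'|\theta^*)\big)(x-x')\ge\nu|x-x'|^2$ for all $x,x'\in\mathbb{R}$, and $\|\nabla_\theta\log p(x|\theta^*)-\nabla_\theta\log p(x'|\theta^*)\|\le L|x-x'|$ for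 all $x,x'\in\mathbb{R}$; 3. $\log\pi$ is concave and differentiable with $L$-Lipschitz gradient on $\mathbb{R}^d$. Put $\kappa=\max\{L/m,L/\nu\}$. For data $X=(X_1,\dots,X_n)\in\mathbb{R}^n$ let $F_n(\theta)=\frac1n\sum_{i=1}^n\log p(X_i|\theta)$, and let the scaled posterior $\mu^{(n)}[\gamma]$ be the probability measure on $\mathbb{R}^d$ with density proportional to $\exp\big(\gamma(nF_n(\theta)+\log\pi(\theta))\big)$. Then the maximum $B=\max_\theta\pi(\theta)/\pi(\theta^*)$ exists, and $\mu^{(n)}[\gamma]$ is well defined (its density is normalizable) for every $X\in\mathbb{R}^n$. Moreover, let $X_1,\dots,X_n$ be i.i.d. with density $p(\cdot|\theta^*)$, and for $0<\delta\le e^{-1/2}$ put $$R_\delta=\sqrt{\frac{2e}{mn}\left(\frac d\gamma+\log B+\left(\frac{32}{\gamma}+8d\kappa^2\right)\log\frac1\delta\right)}.$$ Then for every $\delta\in(0,e^{-1/2}]$ the scaled posterior concentrates around $\theta^*$ at rate $1/\sqrt n$ in both of the following senses: (a) if $X$ is drawn as above and then $\theta\sim\mu^{(n)}[\gamma]$ given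 $X$, then $\mathbb{P}\big(\|\theta-\theta^*\|>R_\delta\big)<\delta$; (b) with probability at least $1-\delta$ over $X$, $\mathbb{P}_{\theta\sim\mu^{(n)}[\gamma]}\big(\|\theta-\theta^*\|>R_\delta\;\big|\;X\big)<\delta$. -/

import Mathlib

open MeasureTheory

noncomputable section

/-- `p x θ` is a family of strictly positive probability densities on `ℝ` (with respect to Lebesgue
measure in the reward `x`), indexed by the parameter `θ ∈ ℝᵈ`. -/
structure IsRewardFamily {d : ℕ} (p : ℝ → EuclideanSpace ℝ (Fin d) → ℝ) : Prop where
  pos : ∀ x θ, 0 < p x θ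
  measurable : ∀ θ, Measurable fun x => p x θ
  lintegral_eq_one : ∀ θ, ∫⁻ x, ENNReal.ofReal (p x θ) = 1

/-- The family is log-concave in the parameter. -/
def IsLogConcaveFamily {d : ℕ} (p : ℝ → EuclideanSpace ℝ (Fin d) → ℝ) : Prop :=
  ∀ x, ConcaveOn ℝ Set.univ fun θ => Real.log (p x θ)

/-- The score `∇_θ log p(x | θ)` at the parameter `θ`. -/
def score {d : ℕ} (p : ℝ → EuclideanSpace ℝ (Fin d) → ℝ)
    (θ : EuclideanSpace ℝ (Fin d)) (x : ℝ) : EuclideanSpace ℝ (Fin d) :=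
  gradient (fun θ' => Real.log (p x θ')) θ

/-- `log p(x | ·)` is `m`-strongly concave and `L`-smooth around `θs`, uniformly in `x`. -/
structure IsLocallyStronglyConcaveSmooth {d : ℕ} (p : ℝ → EuclideanSpace ℝ (Fin d) → ℝ)
    (θs : EuclideanSpace ℝ (Fin d)) (m L : ℝ) : Prop where
  differentiableAt : ∀ x, DifferentiableAt ℝ (fun θ => Real.log (p x θ)) θs
  lower : ∀ x θ, -Real.log (p x θs) - inner ℝ (score p θs x) (θ - θs) + m / 2 * ‖θ - θs‖ ^ 2
    ≤ -Real.log (p x θ)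
  upper : ∀ x θ, -Real.log (p x θ)
    ≤ -Real.log (p x θs) - inner ℝ (score p θs x) (θ - θs) + L / 2 * ‖θ - θs‖ ^ 2

/-- The true reward density `p(· | θs)` is `ν`-strongly log-concave in the reward, and the score at
`θs` is an `L`-Lipschitz function of the reward. -/
structure IsRegularReward {d : ℕ} (p : ℝ → EuclideanSpace ℝ (Fin d) → ℝ)
    (θs : EuclideanSpace ℝ (Fin d)) (ν L : ℝ) : Prop where
  differentiable : Differentiable ℝ fun x => Real.log (p x θs)
  strong : ∀ x x', ν * (x - x') ^ 2 ≤
    -((deriv (fun y => Real.log (p y θs)) x - deriv (fun y => Real.log (p y θs)) x') * (x - x'))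
  lipschitz : ∀ x x', ‖score p θs x - score p θs x'‖ ≤ L * |x - x'|

/-- `π₀` is a probability density on `ℝᵈ` whose logarithm is concave, with `L`-Lipschitz gradient. -/
structure IsRegularPrior {d : ℕ} (π₀ : EuclideanSpace ℝ (Fin d) → ℝ) (L : ℝ) : Prop where
  pos : ∀ θ, 0 < π₀ θ
  lintegral_eq_one : ∫⁻ θ, ENNReal.ofReal (π₀ θ) = 1
  logConcave : ConcaveOn ℝ Set.univ fun θ => Real.log (π₀ θ)
  differentiable : Differentiable ℝ fun θ => Real.log (π₀ θ)
  lipschitz : ∀ θ θ', ‖gradient (fun η => Real.log (π₀ η)) θ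
    - gradient (fun η => Real.log (π₀ η)) θ'‖ ≤ L * ‖θ - θ'‖

/-- The condition number `κ = max {L / m, L / ν}`. -/
def conditionNumber (m ν L : ℝ) : ℝ := max (L / m) (L / ν)

/-- The prior quality `B = max_θ π₀(θ) / π₀(θs)`. -/
def priorQuality {d : ℕ} (π₀ : EuclideanSpace ℝ (Fin d) → ℝ)
    (θs : EuclideanSpace ℝ (Fin d)) : ℝ :=
  ⨆ θ, π₀ θ / π₀ θs

/-- The law of `n` i.i.d. rewards with density `p(· | θs)`. -/
def dataLaw {d : ℕ} (p : ℝ → EuclideanSpace ℝ (Fin d) → ℝ)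
    (θs : EuclideanSpace ℝ (Fin d)) (n : ℕ) : Measure (Fin n → ℝ) :=
  Measure.pi fun _ => volume.withDensity fun x => ENNReal.ofReal (p x θs)

/-- The average log-likelihood `F_n(θ) = (1/n) ∑ᵢ log p(Xᵢ | θ)` of the data `X`. -/
def avgLogLikelihood {d n : ℕ} (p : ℝ → EuclideanSpace ℝ (Fin d) → ℝ)
    (X : Fin n → ℝ) (θ : EuclideanSpace ℝ (Fin d)) : ℝ :=
  1 / (n : ℝ) * ∑ i, Real.log (p (X i) θ)

/-- The unnormalised scaled posterior, of density `exp (γ (n F_n(θ) + log π₀(θ)))`. -/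
def scaledPosteriorWeight {d n : ℕ} (p : ℝ → EuclideanSpace ℝ (Fin d) → ℝ)
    (π₀ : EuclideanSpace ℝ (Fin d) → ℝ) (γ : ℝ) (X : Fin n → ℝ) :
    Measure (EuclideanSpace ℝ (Fin d)) :=
  volume.withDensity fun θ =>
    ENNReal.ofReal (Real.exp (γ * ((n : ℝ) * avgLogLikelihood p X θ + Real.log (π₀ θ))))

/-- The scaled posterior `μ⁽ⁿ⁾[γ]` given the data `X`: the normalisation of
`scaledPosteriorWeight`. -/
def scaledPosterior {d n : ℕ} (p : ℝ → EuclideanSpace ℝ (Fin d) → ℝ)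
    (π₀ : EuclideanSpace ℝ (Fin d) → ℝ) (γ : ℝ) (X : Fin n → ℝ) :
    Measure (EuclideanSpace ℝ (Fin d)) :=
  (scaledPosteriorWeight p π₀ γ X Set.univ)⁻¹ • scaledPosteriorWeight p π₀ γ X

/-- The radius
`√(2e / (m n) · (d / γ + log B + (32 / γ + 8 d κ²) log (1 / δ)))`. -/
def contractionRadius (d n : ℕ) (m γ B κ δ : ℝ) : ℝ :=
  Real.sqrt (2 * Real.exp 1 / (m * n) *
    (d / γ + Real.log B + (32 / γ + 8 * d * κ ^ 2) * Real.log (1 / δ)))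

end

/-! The data enter the tail bound only through the total score `S` at `θs`. By strong concavity the
log-posterior `U` satisfies `U θ - U θs ≤ γ (‖S‖ r - n m r² / 2 + log B)` with `r = ‖θ - θs‖`, so
two facts suffice: `‖S‖²` is rarely larger than order `n d L log (1/δ)`, and a concave `U` that has
dropped by `a` leaves little mass behind.

The first is a change of parameter: smoothness gives `p x θs * exp ⟪score, v⟫ ≤ exp (L ‖v‖² / 2) * p
x (θs + v)`, and the right-hand density integrates to one. Hence each coordinate of the score is
sub-Gaussian. Independence, a bound on `E exp (Sᵢ² / (4 n L))` and Markov's inequality give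
`dataLaw_lt_norm_totalScore_le`, used with failure probability `√2 δ^e`.

The second is `withDensity_exp_le_of_concaveOn`: flattening `U` to `(1 - s) U` costs at most `(1 -
s)⁻ᵈ` in total mass, while a drop of `a` gains `exp (-s a)`. With `s = 1/4` the posterior tail is at
most `δ^10` on the good event, and `√2 δ^e + δ^10 < δ` yields both claims. -/

/-! ### Integrable log-concave functions attain their maximum -/

/-- The set `f 0 ≤ f x` is bounded: a far point `x` in it would force a fixed amount of mass near `x
/ 2`, against tightness of the finite measure with density `f`. -/
theorem exists_max_of_concaveOn_log {E : Type*} [NormedAddCommGroup E] [NormedSpace ℝ E]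
    [FiniteDimensional ℝ E] [MeasurableSpace E] [BorelSpace E] (μ : Measure E)
    [μ.IsAddHaarMeasure] {f : E → ℝ} (hpos : ∀ x, 0 < f x)
    (hf : ConcaveOn ℝ Set.univ fun x => Real.log (f x))
    (hint : ∫⁻ x, ENNReal.ofReal (f x) ∂μ ≠ ⊤) : ∃ x₀, ∀ x, f x ≤ f x₀ := by
  have hlog : Continuous fun x => Real.log (f x) :=
    continuousOn_univ.1 (hf.continuousOn isOpen_univ)
  have hcont : Continuous f := by
    have := Real.continuous_exp.comp hlog
    refine this.congr fun x => ?_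
    simp [Real.exp_log (hpos x)]
  refine hcont.exists_forall_ge_of_isBounded 0 ?_
  obtain ⟨r, hr, hball⟩ : ∃ r > 0, ∀ y ∈ Metric.ball (0 : E) r,
      Real.log (f 0) - 1 < Real.log (f y) := by
    have := hlog.continuousAt.eventually
      (lt_mem_nhds (show Real.log (f 0) - 1 < Real.log (f 0) by linarith))
    exact Metric.eventually_nhds_iff_ball.1 this
  set c : ℝ := Real.exp (Real.log (f 0) - 1 / 2) with hc
  have hmid : ∀ x, f 0 ≤ f x → ∀ y ∈ Metric.ball ((2⁻¹ : ℝ) • x) (r / 2), c ≤ f y := by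
    intro x hx y hy
    -- `y` is the midpoint of `x` and `z`, and `z` is close to `0`, so concavity bounds `log (f y)`
    -- below.
    set z : E := (2 : ℝ) • y - x with hz
    have hzb : z ∈ Metric.ball (0 : E) r := by
      have h2 : z = (2 : ℝ) • (y - (2⁻¹ : ℝ) • x) := by
        rw [hz, smul_sub, smul_smul]; norm_num
      rw [mem_ball_iff_norm] at hy
      rw [mem_ball_zero_iff, h2, norm_smul]
      norm_num
      linarith
    have hy2 : y = (2⁻¹ : ℝ) • x + (2⁻¹ : ℝ) • z := by
      rw [hz, smul_sub, smul_smul]; norm_num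
    have h := hf.2 (Set.mem_univ x) (Set.mem_univ z) (show (0 : ℝ) ≤ 2⁻¹ by norm_num)
      (show (0 : ℝ) ≤ 2⁻¹ by norm_num) (by norm_num)
    rw [← hy2] at h
    simp only [smul_eq_mul] at h
    have h1 := Real.log_le_log (hpos 0) hx
    have h2 := hball z hzb
    rw [hc, ← Real.le_log_iff_exp_le (hpos y)]
    linarith
  set ρ : Measure E := μ.withDensity fun x => ENNReal.ofReal (f x) with hρ
  have : IsFiniteMeasure ρ := isFiniteMeasure_withDensity hint
  set ε : ENNReal := ENNReal.ofReal c * μ (Metric.ball 0 (r / 2)) with hε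
  have hεpos : 0 < ε := by
    refine ENNReal.mul_pos ?_ ?_
    · simp [hc, Real.exp_pos]
    · exact (Metric.measure_ball_pos μ 0 (by positivity)).ne'
  have htight := tendsto_measure_norm_gt_of_isTightMeasureSet
    (isTightMeasureSet_singleton (μ := ρ))
  simp only [Set.mem_singleton_iff, iSup_iSup_eq_left] at htight
  obtain ⟨T, hT⟩ := (htight.eventually (gt_mem_nhds hεpos)).exists
  refine (Metric.isBounded_closedBall (x := (0 : E)) (r := 2 * (T + r))).subset fun x hx => ?_
  rw [mem_closedBall_zero_iff]
  by_contra! hbig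
  refine absurd hT (not_lt.2 ?_)
  have hsub : Metric.ball ((2⁻¹ : ℝ) • x) (r / 2) ⊆ {y | T < ‖y‖} := by
    intro y hy
    rw [mem_ball_iff_norm'] at hy
    have h1 := norm_sub_norm_le ((2⁻¹ : ℝ) • x) y
    have h2 : ‖(2⁻¹ : ℝ) • x‖ = 2⁻¹ * ‖x‖ := by rw [norm_smul]; norm_num
    simp only [Set.mem_ofPred_eq]
    linarith
  calc ε = ∫⁻ _ in Metric.ball ((2⁻¹ : ℝ) • x) (r / 2), ENNReal.ofReal c ∂μ := by
        rw [setLIntegral_const, hε, Measure.addHaar_ball_center μ ((2⁻¹ : ℝ) • x)]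
    _ ≤ ∫⁻ y in Metric.ball ((2⁻¹ : ℝ) • x) (r / 2), ENNReal.ofReal (f y) ∂μ :=
        setLIntegral_mono' measurableSet_ball fun y hy =>
          ENNReal.ofReal_le_ofReal (hmid x hx y hy)
    _ = ρ (Metric.ball ((2⁻¹ : ℝ) • x) (r / 2)) := (withDensity_apply _ measurableSet_ball).symm
    _ ≤ ρ {y | T < ‖y‖} := measure_mono hsub

/-! ### Tails of log-concave measures -/

/-- Concavity along the segment from `c` gives `t (U x - U c) ≤ U (c + t (x - c)) - U c`; the
dilation by `t` then contributes its Jacobian. -/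
theorem lintegral_exp_mul_le_of_concaveOn {E : Type*} [NormedAddCommGroup E] [NormedSpace ℝ E]
    [FiniteDimensional ℝ E] [MeasurableSpace E] [BorelSpace E] (μ : Measure E)
    [μ.IsAddHaarMeasure] {U : E → ℝ} (hU : ConcaveOn ℝ Set.univ U) (c : E) {t : ℝ}
    (ht : 0 < t) (ht1 : t ≤ 1) :
    ∫⁻ x, ENNReal.ofReal (Real.exp (t * (U x - U c))) ∂μ ≤
      ENNReal.ofReal ((t ^ Module.finrank ℝ E)⁻¹) *
        ∫⁻ x, ENNReal.ofReal (Real.exp (U x - U c)) ∂μ := by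
  have hcont : Continuous U := continuousOn_univ.1 (hU.continuousOn isOpen_univ)
  set g : E → ENNReal := fun x => ENNReal.ofReal (Real.exp (U (c + x) - U c)) with hg
  have hgm : Measurable g := by
    have := hcont.measurable
    fun_prop
  calc ∫⁻ x, ENNReal.ofReal (Real.exp (t * (U x - U c))) ∂μ
      ≤ ∫⁻ x, g (t • (x - c)) ∂μ := by
        refine lintegral_mono fun x => ENNReal.ofReal_le_ofReal (Real.exp_le_exp.2 ?_)
        have h := hU.2 (Set.mem_univ c) (Set.mem_univ x) (sub_nonneg.2 ht1) ht.le (by ring)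
        have hx : (1 - t) • c + t • x = c + t • (x - c) := by module
        rw [hx] at h
        simp only [smul_eq_mul] at h
        linarith
    _ = ∫⁻ x, g (t • x) ∂μ := lintegral_sub_right_eq_self (μ := μ) (fun x => g (t • x)) c
    _ = ∫⁻ x, g x ∂(Measure.map (t • ·) μ) :=
        (lintegral_map hgm (measurable_const_smul t)).symm
    _ = ENNReal.ofReal ((t ^ Module.finrank ℝ E)⁻¹) * ∫⁻ x, g x ∂μ := by
        rw [Measure.map_addHaar_smul μ ht.ne', lintegral_smul_measure, abs_of_pos (by positivity),
          smul_eq_mul]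
    _ = _ := by
        rw [hg, lintegral_add_left_eq_self (μ := μ)
          (fun x => ENNReal.ofReal (Real.exp (U x - U c))) c]

theorem withDensity_exp_le_of_concaveOn {E : Type*} [NormedAddCommGroup E] [NormedSpace ℝ E]
    [FiniteDimensional ℝ E] [MeasurableSpace E] [BorelSpace E] (μ : Measure E)
    [μ.IsAddHaarMeasure] {U : E → ℝ} (hU : ConcaveOn ℝ Set.univ U) (c : E) {s a : ℝ}
    (hs : 0 ≤ s) (hs1 : s < 1) {A : Set E} (hA : MeasurableSet A)
    (h : ∀ x ∈ A, U x - U c ≤ -a) :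
    (μ.withDensity fun x => ENNReal.ofReal (Real.exp (U x))) A ≤
      ENNReal.ofReal (((1 - s) ^ Module.finrank ℝ E)⁻¹ * Real.exp (-(s * a))) *
        (μ.withDensity fun x => ENNReal.ofReal (Real.exp (U x))) Set.univ := by
  have hcont : Continuous U := continuousOn_univ.1 (hU.continuousOn isOpen_univ)
  have hs0 : 0 < 1 - s := by linarith
  rw [withDensity_apply _ hA, withDensity_apply _ MeasurableSet.univ, Measure.restrict_univ]
  have hsplit : ∀ x, ENNReal.ofReal (Real.exp (U x)) =
      ENNReal.ofReal (Real.exp (U c)) * ENNReal.ofReal (Real.exp (U x - U c)) := by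
    intro x
    rw [← ENNReal.ofReal_mul (Real.exp_pos _).le, ← Real.exp_add]
    congr 2; ring
  calc ∫⁻ x in A, ENNReal.ofReal (Real.exp (U x)) ∂μ
      ≤ ∫⁻ x in A, ENNReal.ofReal (Real.exp (U c) * Real.exp (-(s * a))) *
          ENNReal.ofReal (Real.exp ((1 - s) * (U x - U c))) ∂μ := by
        refine setLIntegral_mono' hA fun x hx => ?_
        rw [← ENNReal.ofReal_mul (by positivity), ← Real.exp_add, ← Real.exp_add]
        refine ENNReal.ofReal_le_ofReal (Real.exp_le_exp.2 ?_)
        -- On `A`, the share `s` of `U x - U c` is spent on the factor `exp (-s a)`; the share `1 -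
        -- s` is kept for the integral.
        nlinarith [mul_le_mul_of_nonneg_left (h x hx) hs]
    _ ≤ ∫⁻ x, ENNReal.ofReal (Real.exp (U c) * Real.exp (-(s * a))) *
          ENNReal.ofReal (Real.exp ((1 - s) * (U x - U c))) ∂μ := setLIntegral_le_lintegral _ _
    _ = ENNReal.ofReal (Real.exp (U c) * Real.exp (-(s * a))) *
          ∫⁻ x, ENNReal.ofReal (Real.exp ((1 - s) * (U x - U c))) ∂μ :=
        lintegral_const_mul' _ _ ENNReal.ofReal_ne_top
    _ ≤ ENNReal.ofReal (Real.exp (U c) * Real.exp (-(s * a))) *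
          (ENNReal.ofReal (((1 - s) ^ Module.finrank ℝ E)⁻¹) *
            ∫⁻ x, ENNReal.ofReal (Real.exp (U x - U c)) ∂μ) := by
        gcongr
        exact lintegral_exp_mul_le_of_concaveOn μ hU c hs0 (by linarith)
    _ = _ := by
        rw [lintegral_congr hsplit, lintegral_const_mul' _ _ ENNReal.ofReal_ne_top,
          ENNReal.ofReal_mul (Real.exp_pos _).le, ENNReal.ofReal_mul (by positivity)]
        ring

/-! ### Gaussian integrals and squares of sub-Gaussian variables -/

theorem lintegral_exp_lt_top_of_le_quadratic {V : Type*} [NormedAddCommGroup V]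
    [InnerProductSpace ℝ V] [FiniteDimensional ℝ V] [MeasurableSpace V] [BorelSpace V]
    {U : V → ℝ} (c : V) {K b q : ℝ} (hq : 0 < q)
    (h : ∀ x, U x ≤ K + b * ‖x - c‖ - q * ‖x - c‖ ^ 2) :
    ∫⁻ x, ENNReal.ofReal (Real.exp (U x)) < ⊤ := by
  have hint : Integrable fun x : V => Real.exp (-(q / 2) * ‖x‖ ^ 2) := by
    have := (GaussianFourier.integrable_cexp_neg_mul_sq_norm_add (V := V) (b := ((q / 2 : ℝ) : ℂ))
      (by simpa using hq) 0 0).re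
    refine this.congr (Filter.Eventually.of_forall fun x => ?_)
    simp only [zero_mul, add_zero]
    rw [← Complex.exp_ofReal_re]
    push_cast
    rfl
  have hle : ∀ x, ENNReal.ofReal (Real.exp (U x)) ≤
      ENNReal.ofReal (Real.exp (K + b ^ 2 / (2 * q)) *
        Real.exp (-(q / 2) * ‖x - c‖ ^ 2)) := by
    intro x
    rw [← Real.exp_add]
    refine ENNReal.ofReal_le_ofReal (Real.exp_le_exp.2 ((h x).trans ?_))
    -- Half of the quadratic term absorbs the linear one; the other half remains as a Gaussian.
    have h2 : b ^ 2 / (2 * q) - b * ‖x - c‖ + q / 2 * ‖x - c‖ ^ 2 =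
      (b - q * ‖x - c‖) ^ 2 / (2 * q) := by field_simp; ring
    have h3 : 0 ≤ (b - q * ‖x - c‖) ^ 2 / (2 * q) := by positivity
    linarith
  refine (lintegral_mono hle).trans_lt ?_
  have h2 := ((hint.comp_sub_right c).const_mul (Real.exp (K + b ^ 2 / (2 * q)))).lintegral_lt_top
  exact h2

/-- Writes the exponential of a square as a Gaussian mixture of exponentials linear in `y`, to which
a moment generating function bound applies. -/
theorem lintegral_exp_mul_sub_sq (y : ℝ) :
    ∫⁻ t : ℝ, ENNReal.ofReal (Real.exp (t * y - t ^ 2)) =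
      ENNReal.ofReal (√Real.pi) * ENNReal.ofReal (Real.exp (y ^ 2 / 4)) := by
  have h0 : ∫⁻ t : ℝ, ENNReal.ofReal (Real.exp (-1 * t ^ 2)) = ENNReal.ofReal (√Real.pi) := by
    rw [← ofReal_integral_eq_lintegral_ofReal (integrable_exp_neg_mul_sq one_pos)
      (Filter.Eventually.of_forall fun _ => (Real.exp_pos _).le), integral_gaussian, div_one]
  calc ∫⁻ t : ℝ, ENNReal.ofReal (Real.exp (t * y - t ^ 2))
      = ∫⁻ t : ℝ, ENNReal.ofReal (Real.exp (y ^ 2 / 4)) *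
          ENNReal.ofReal (Real.exp (-1 * (t - y / 2) ^ 2)) := by
        refine lintegral_congr fun t => ?_
        rw [← ENNReal.ofReal_mul (Real.exp_pos _).le, ← Real.exp_add]
        congr 2; ring
    _ = _ := by
        rw [lintegral_const_mul' _ _ ENNReal.ofReal_ne_top,
          lintegral_sub_right_eq_self (fun t : ℝ => ENNReal.ofReal (Real.exp (-1 * t ^ 2))) (y / 2),
          h0, mul_comm]

/-- After Tonelli, the sub-Gaussian bound replaces `exp (-t²)` by `exp (-t² / 2)`; `√2` is the ratio
of the two Gaussian integrals. -/
theorem ProbabilityTheory.HasSubgaussianMGF.lintegral_exp_sq_le {Ω : Type*} [MeasurableSpace Ω]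
    {P : Measure Ω} [SFinite P] {Y : Ω → ℝ} {c : NNReal} (hc : 0 < c)
    (hY : ProbabilityTheory.HasSubgaussianMGF Y c P) (hYm : Measurable Y) :
    ∫⁻ ω, ENNReal.ofReal (Real.exp (Y ω ^ 2 / (4 * c))) ∂P ≤ ENNReal.ofReal (√2) := by
  have hc' : (0 : ℝ) < c := hc
  have hsq : √(c : ℝ) ^ 2 = c := Real.sq_sqrt hc'.le
  have hsc : 0 < √(c : ℝ) := Real.sqrt_pos.2 hc'
  have hpi : ENNReal.ofReal (√Real.pi) ≠ 0 := by
    simpa using Real.pi_pos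
  refine (ENNReal.mul_le_mul_iff_right hpi ENNReal.ofReal_ne_top).1 ?_
  calc ENNReal.ofReal (√Real.pi) * ∫⁻ ω, ENNReal.ofReal (Real.exp (Y ω ^ 2 / (4 * c))) ∂P
      = ∫⁻ ω, (∫⁻ t : ℝ, ENNReal.ofReal (Real.exp (t * (Y ω / √(c : ℝ)) - t ^ 2))) ∂P := by
        rw [← lintegral_const_mul' _ _ ENNReal.ofReal_ne_top]
        refine lintegral_congr fun ω => ?_
        rw [lintegral_exp_mul_sub_sq, div_pow, hsq, div_div, mul_comm (c : ℝ) 4]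
    _ = ∫⁻ t : ℝ, ∫⁻ ω, ENNReal.ofReal (Real.exp (t * (Y ω / √(c : ℝ)) - t ^ 2)) ∂P := by
        refine lintegral_lintegral_swap ?_
        refine Measurable.aemeasurable ?_
        simp only [Function.uncurry_def]
        fun_prop
    _ ≤ ∫⁻ t : ℝ, ENNReal.ofReal (Real.exp (-(1 / 2) * t ^ 2)) := by
        refine lintegral_mono fun t => ?_
        have h1 : ∀ ω, ENNReal.ofReal (Real.exp (t * (Y ω / √(c : ℝ)) - t ^ 2)) =
            ENNReal.ofReal (Real.exp (-t ^ 2)) *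
              ENNReal.ofReal (Real.exp (t / √(c : ℝ) * Y ω)) := by
          intro ω
          rw [← ENNReal.ofReal_mul (Real.exp_pos _).le, ← Real.exp_add]
          congr 2; ring
        simp_rw [h1]
        rw [lintegral_const_mul' _ _ ENNReal.ofReal_ne_top,
          ← ofReal_integral_eq_lintegral_ofReal (hY.integrable_exp_mul _)
            (Filter.Eventually.of_forall fun _ => (Real.exp_pos _).le),
          ← ENNReal.ofReal_mul (Real.exp_pos _).le]
        refine ENNReal.ofReal_le_ofReal ?_
        have h2 := hY.mgf_le (t / √(c : ℝ))
        rw [div_pow, hsq, mul_div_cancel₀ _ hc'.ne'] at h2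
        refine (mul_le_mul_of_nonneg_left h2 (Real.exp_pos _).le).trans_eq ?_
        rw [← Real.exp_add]
        congr 1; ring
    _ = ENNReal.ofReal (√Real.pi) * ENNReal.ofReal (√2) := by
        rw [← ofReal_integral_eq_lintegral_ofReal (integrable_exp_neg_mul_sq (by norm_num))
          (Filter.Eventually.of_forall fun _ => (Real.exp_pos _).le), integral_gaussian,
          ← ENNReal.ofReal_mul (Real.sqrt_nonneg _), ← Real.sqrt_mul Real.pi_pos.le]
        congr 2; ring

/-! ### Concentration of the score -/

section Reward

variable {d : ℕ} {p : ℝ → EuclideanSpace ℝ (Fin d) → ℝ} {θs : EuclideanSpace ℝ (Fin d)}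
  {m L ν : ℝ}

theorem IsRewardFamily.isProbabilityMeasure (hp : IsRewardFamily p)
    (θ : EuclideanSpace ℝ (Fin d)) :
    IsProbabilityMeasure (volume.withDensity fun x => ENNReal.ofReal (p x θ)) :=
  ⟨by rw [withDensity_apply _ MeasurableSet.univ, Measure.restrict_univ, hp.lintegral_eq_one]⟩

theorem IsRegularReward.continuous_score (h2 : IsRegularReward p θs ν L) :
    Continuous (score p θs) := by
  refine (LipschitzWith.of_dist_le' (K := L) fun x y => ?_).continuous
  rw [dist_eq_norm, Real.dist_eq]
  exact h2.lipschitz x y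

/-- Compares the two quadratic bounds at distance one from `θs`, which needs a nonzero vector. -/
theorem IsLocallyStronglyConcaveSmooth.le [NeZero d]
    (h1 : IsLocallyStronglyConcaveSmooth p θs m L) : m ≤ L := by
  set v : EuclideanSpace ℝ (Fin d) := EuclideanSpace.single 0 1
  have hv : ‖v‖ = 1 := by simp [v]
  have h := (h1.lower 0 (θs + v)).trans (h1.upper 0 (θs + v))
  rw [add_sub_cancel_left, hv] at h
  linarith

/-- The smoothness bound at `θs + v` dominates the tilted density by a multiple of the density with
parameter `θs + v`, whose mass is one. -/
theorem IsLocallyStronglyConcaveSmooth.lintegral_exp_inner_score_le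
    (h1 : IsLocallyStronglyConcaveSmooth p θs m L) (h2 : IsRegularReward p θs ν L)
    (hp : IsRewardFamily p) (v : EuclideanSpace ℝ (Fin d)) :
    ∫⁻ x, ENNReal.ofReal (Real.exp (inner ℝ (score p θs x) v))
        ∂(volume.withDensity fun x => ENNReal.ofReal (p x θs)) ≤
      ENNReal.ofReal (Real.exp (L / 2 * ‖v‖ ^ 2)) := by
  have hs := h2.continuous_score
  rw [lintegral_withDensity_eq_lintegral_mul _ (hp.measurable θs).ennreal_ofReal
    (by apply Measurable.ennreal_ofReal; apply Continuous.measurable; fun_prop)]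
  calc ∫⁻ x, ENNReal.ofReal (p x θs) * ENNReal.ofReal (Real.exp (inner ℝ (score p θs x) v))
      ≤ ∫⁻ x, ENNReal.ofReal (Real.exp (L / 2 * ‖v‖ ^ 2)) * ENNReal.ofReal (p x (θs + v)) := by
        refine lintegral_mono fun x => ?_
        rw [← ENNReal.ofReal_mul (hp.pos x θs).le, ← ENNReal.ofReal_mul (Real.exp_pos _).le]
        refine ENNReal.ofReal_le_ofReal ?_
        have h := h1.upper x (θs + v)
        rw [add_sub_cancel_left] at h
        rw [← Real.exp_log (hp.pos x θs), ← Real.exp_log (hp.pos x (θs + v)), ← Real.exp_add,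
          ← Real.exp_add]
        exact Real.exp_le_exp.2 (by linarith)
    _ = _ := by
        rw [lintegral_const_mul' _ _ ENNReal.ofReal_ne_top, hp.lintegral_eq_one, mul_one]

theorem IsLocallyStronglyConcaveSmooth.hasSubgaussianMGF_score
    (h1 : IsLocallyStronglyConcaveSmooth p θs m L) (h2 : IsRegularReward p θs ν L)
    (hp : IsRewardFamily p) (hL : 0 ≤ L) (i : Fin d) :
    ProbabilityTheory.HasSubgaussianMGF (fun x => score p θs x i) L.toNNReal
      (volume.withDensity fun x => ENNReal.ofReal (p x θs)) := by
  have hs := h2.continuous_score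
  have key : ∀ t : ℝ, ∫⁻ x, ENNReal.ofReal (Real.exp (t * score p θs x i))
      ∂(volume.withDensity fun x => ENNReal.ofReal (p x θs)) ≤
      ENNReal.ofReal (Real.exp (L * t ^ 2 / 2)) := by
    intro t
    have h := h1.lintegral_exp_inner_score_le h2 hp (EuclideanSpace.single i t)
    have hn : L / 2 * ‖EuclideanSpace.single i t‖ ^ 2 = L * t ^ 2 / 2 := by
      simp; ring
    rw [hn] at h
    simpa [EuclideanSpace.inner_single_right] using h
  have hm : ∀ t : ℝ, Continuous fun x => Real.exp (t * score p θs x i) := by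
    intro t
    fun_prop
  refine ⟨fun t => ⟨(hm t).aestronglyMeasurable, ?_⟩, fun t => ?_⟩
  · rw [hasFiniteIntegral_iff_ofReal (Filter.Eventually.of_forall fun _ => (Real.exp_pos _).le)]
    exact (key t).trans_lt ENNReal.ofReal_lt_top
  · rw [Real.coe_toNNReal L hL, ProbabilityTheory.mgf, integral_eq_lintegral_of_nonneg_ae
      (Filter.Eventually.of_forall fun _ => (Real.exp_pos _).le) (hm t).aestronglyMeasurable]
    exact ENNReal.toReal_le_of_le_ofReal (Real.exp_pos _).le (key t)

/-- The total score of the data, `∑ⱼ ∇_θ log p(Xⱼ | θ)`. -/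
noncomputable def totalScore {d n : ℕ} (p : ℝ → EuclideanSpace ℝ (Fin d) → ℝ)
    (θ : EuclideanSpace ℝ (Fin d)) (X : Fin n → ℝ) : EuclideanSpace ℝ (Fin d) :=
  ∑ j, score p θ (X j)

theorem IsRegularReward.continuous_totalScore (h2 : IsRegularReward p θs ν L) (n : ℕ) :
    Continuous (totalScore (n := n) p θs) := by
  have hs := h2.continuous_score
  unfold totalScore
  fun_prop

theorem IsLocallyStronglyConcaveSmooth.hasSubgaussianMGF_totalScore
    (h1 : IsLocallyStronglyConcaveSmooth p θs m L) (h2 : IsRegularReward p θs ν L)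
    (hp : IsRewardFamily p) (hL : 0 ≤ L) (n : ℕ) (i : Fin d) :
    ProbabilityTheory.HasSubgaussianMGF (fun X => totalScore p θs X i) (n * L.toNNReal)
      (dataLaw p θs n) := by
  have := hp.isProbabilityMeasure θs
  have hs := h2.continuous_score
  have hsi : Measurable fun x => score p θs x i := Continuous.measurable (by fun_prop)
  have hind : ProbabilityTheory.iIndepFun (fun (j : Fin n) (X : Fin n → ℝ) => score p θs (X j) i)
      (dataLaw p θs n) :=
    ProbabilityTheory.iIndepFun_pi (X := fun _ x => score p θs x i) fun _ => hsi.aemeasurable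
  have hj : ∀ j ∈ Finset.univ, ProbabilityTheory.HasSubgaussianMGF
      (fun X : Fin n → ℝ => score p θs (X j) i) L.toNNReal (dataLaw p θs n) := by
    intro j _
    have hmp : MeasurePreserving (Function.eval j) (dataLaw p θs n)
        (volume.withDensity fun x => ENNReal.ofReal (p x θs)) :=
      measurePreserving_eval (fun _ : Fin n => volume.withDensity fun x => ENNReal.ofReal (p x θs)) j
    refine ProbabilityTheory.HasSubgaussianMGF.of_map (X := fun x => score p θs x i)
      (Y := Function.eval j) hmp.measurable.aemeasurable ?_
    rw [hmp.map_eq]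
    exact h1.hasSubgaussianMGF_score h2 hp hL i
  have h := ProbabilityTheory.HasSubgaussianMGF.sum_of_iIndepFun (c := fun _ => L.toNNReal) hind hj
  have hc : ∑ _j : Fin n, L.toNNReal = n * L.toNNReal := by
    rw [Finset.sum_const, Finset.card_univ, Fintype.card_fin, nsmul_eq_mul]
  rw [hc] at h
  simpa only [totalScore, WithLp.ofLp_sum, Finset.sum_apply] using h

theorem IsRewardFamily.isProbabilityMeasure_dataLaw (hp : IsRewardFamily p) (n : ℕ) :
    IsProbabilityMeasure (dataLaw p θs n) := by
  have := hp.isProbabilityMeasure θs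
  unfold dataLaw
  infer_instance

theorem IsLocallyStronglyConcaveSmooth.dataLaw_lt_norm_totalScore_le [NeZero d]
    (h1 : IsLocallyStronglyConcaveSmooth p θs m L) (h2 : IsRegularReward p θs ν L)
    (hp : IsRewardFamily p) (hL : 0 < L) {n : ℕ} (hn : 0 < n) (u : ℝ) :
    dataLaw p θs n {X | 4 * u * d * n * L < ‖totalScore p θs X‖ ^ 2} ≤
      ENNReal.ofReal (√2 * Real.exp (-u)) := by
  have := hp.isProbabilityMeasure_dataLaw (θs := θs) n
  have hS := h2.continuous_totalScore n
  have hd : (0 : ℝ) < d := by exact_mod_cast Nat.pos_of_ne_zero (NeZero.ne d)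
  have hn' : (0 : ℝ) < n := by exact_mod_cast hn
  -- Averaging the exponentials over coordinates, rather than taking a union bound, avoids a
  -- prefactor `d`; by Jensen the average dominates `exp (‖S‖² / (4 d n L))`.
  set φ : (Fin n → ℝ) → ENNReal := fun X => ∑ i : Fin d, ENNReal.ofReal ((d : ℝ)⁻¹) *
    ENNReal.ofReal (Real.exp (totalScore p θs X i ^ 2 / (4 * (n * L)))) with hφ
  have hφm : ∀ i : Fin d, Measurable fun X : Fin n → ℝ =>
      ENNReal.ofReal (Real.exp (totalScore p θs X i ^ 2 / (4 * (n * L)))) := by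
    intro i
    apply Measurable.ennreal_ofReal; apply Continuous.measurable; fun_prop
  have hbound : ∫⁻ X, φ X ∂(dataLaw p θs n) ≤ ENNReal.ofReal (√2) := by
    rw [hφ, lintegral_finsetSum _ fun i _ => (hφm i).const_mul _]
    calc ∑ i : Fin d, ∫⁻ X, ENNReal.ofReal ((d : ℝ)⁻¹) *
          ENNReal.ofReal (Real.exp (totalScore p θs X i ^ 2 / (4 * (n * L)))) ∂(dataLaw p θs n)
        ≤ ∑ i : Fin d, ENNReal.ofReal ((d : ℝ)⁻¹) * ENNReal.ofReal (√2) := by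
          refine Finset.sum_le_sum fun i _ => ?_
          rw [lintegral_const_mul' _ _ ENNReal.ofReal_ne_top]
          gcongr
          have hc : (0 : NNReal) < n * L.toNNReal :=
            mul_pos (by exact_mod_cast hn) (Real.toNNReal_pos.2 hL)
          have h := (h1.hasSubgaussianMGF_totalScore h2 hp hL.le n i).lintegral_exp_sq_le hc
            (Continuous.measurable (by fun_prop))
          rwa [NNReal.coe_mul, NNReal.coe_natCast, Real.coe_toNNReal L hL.le] at h
      _ = ENNReal.ofReal (√2) := by
          rw [Finset.sum_const, Finset.card_univ, Fintype.card_fin, nsmul_eq_mul, ← mul_assoc,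
            ← ENNReal.ofReal_natCast d, ← ENNReal.ofReal_mul hd.le, mul_inv_cancel₀ hd.ne',
            ENNReal.ofReal_one, one_mul]
  have hsub : {X | 4 * u * d * n * L < ‖totalScore p θs X‖ ^ 2} ⊆
      {X | ENNReal.ofReal (Real.exp u) ≤ φ X} := by
    intro X hX
    simp only [Set.mem_ofPred_eq] at hX ⊢
    have hφ' : φ X = ENNReal.ofReal (∑ i : Fin d, (d : ℝ)⁻¹ •
        Real.exp (totalScore p θs X i ^ 2 / (4 * (n * L)))) := by
      rw [ENNReal.ofReal_sum_of_nonneg fun i _ => by positivity]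
      refine Finset.sum_congr rfl fun i _ => ?_
      rw [smul_eq_mul, ENNReal.ofReal_mul (by positivity)]
    rw [hφ']
    refine ENNReal.ofReal_le_ofReal (le_trans ?_ (convexOn_exp.map_sum_le
      (fun _ _ => by positivity) (by simp [hd.ne']) fun _ _ => Set.mem_univ _))
    refine Real.exp_le_exp.2 ?_
    rw [EuclideanSpace.real_norm_sq_eq] at hX
    simp only [smul_eq_mul]
    rw [← Finset.mul_sum, ← Finset.sum_div, inv_mul_eq_div, div_div, le_div_iff₀ (by positivity)]
    linarith
  calc dataLaw p θs n {X | 4 * u * d * n * L < ‖totalScore p θs X‖ ^ 2}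
      ≤ dataLaw p θs n {X | ENNReal.ofReal (Real.exp u) ≤ φ X} := measure_mono hsub
    _ ≤ (∫⁻ X, φ X ∂(dataLaw p θs n)) / ENNReal.ofReal (Real.exp u) :=
        meas_ge_le_lintegral_div
          (Finset.measurable_sum _ fun i _ => (hφm i).const_mul _).aemeasurable
          (by simp [Real.exp_pos]) ENNReal.ofReal_ne_top
    _ ≤ ENNReal.ofReal (√2) / ENNReal.ofReal (Real.exp u) := by gcongr
    _ = _ := by
        rw [← ENNReal.ofReal_div_of_pos (Real.exp_pos _), Real.exp_neg, div_eq_mul_inv]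

end Reward

/-! ### The scaled posterior and its tail -/

section Posterior

variable {d n : ℕ} {p : ℝ → EuclideanSpace ℝ (Fin d) → ℝ} {π₀ : EuclideanSpace ℝ (Fin d) → ℝ}
  {θs : EuclideanSpace ℝ (Fin d)} {m L ν γ : ℝ}

theorem IsRegularPrior.exists_max (h3 : IsRegularPrior π₀ L) : ∃ θ₀, ∀ θ, π₀ θ ≤ π₀ θ₀ :=
  exists_max_of_concaveOn_log volume h3.pos h3.logConcave (by simp [h3.lintegral_eq_one])

theorem IsRegularPrior.div_le_priorQuality (h3 : IsRegularPrior π₀ L)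
    (θ θs : EuclideanSpace ℝ (Fin d)) : π₀ θ / π₀ θs ≤ priorQuality π₀ θs := by
  obtain ⟨θ₀, h₀⟩ := h3.exists_max
  refine le_ciSup (f := fun θ => π₀ θ / π₀ θs) ⟨π₀ θ₀ / π₀ θs, ?_⟩ θ
  rintro _ ⟨θ, rfl⟩
  exact div_le_div_of_nonneg_right (h₀ θ) (h3.pos θs).le

theorem IsRegularPrior.one_le_priorQuality (h3 : IsRegularPrior π₀ L)
    (θs : EuclideanSpace ℝ (Fin d)) : 1 ≤ priorQuality π₀ θs := by
  have h := h3.div_le_priorQuality θs θs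
  rwa [div_self (h3.pos θs).ne'] at h

theorem IsRegularPrior.log_sub_log_le (h3 : IsRegularPrior π₀ L)
    (θ θs : EuclideanSpace ℝ (Fin d)) :
    Real.log (π₀ θ) - Real.log (π₀ θs) ≤ Real.log (priorQuality π₀ θs) := by
  rw [← Real.log_div (h3.pos θ).ne' (h3.pos θs).ne']
  exact Real.log_le_log (div_pos (h3.pos θ) (h3.pos θs)) (h3.div_le_priorQuality θ θs)

theorem natCast_mul_avgLogLikelihood (hn : 0 < n) (X : Fin n → ℝ)
    (θ : EuclideanSpace ℝ (Fin d)) :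
    (n : ℝ) * avgLogLikelihood p X θ = ∑ i, Real.log (p (X i) θ) := by
  have : (n : ℝ) ≠ 0 := by exact_mod_cast hn.ne'
  rw [avgLogLikelihood]
  field_simp

theorem concaveOn_logPosterior (hn : 0 < n) (hγ : 0 < γ) (hconc : IsLogConcaveFamily p)
    (h3 : IsRegularPrior π₀ L) (X : Fin n → ℝ) :
    ConcaveOn ℝ Set.univ fun θ =>
      γ * ((n : ℝ) * avgLogLikelihood p X θ + Real.log (π₀ θ)) := by
  simp_rw [natCast_mul_avgLogLikelihood hn]
  have hsum : ConcaveOn ℝ Set.univ fun θ => ∑ i, Real.log (p (X i) θ) := by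
    have : ∀ s : Finset (Fin n), ConcaveOn ℝ Set.univ fun θ => ∑ i ∈ s, Real.log (p (X i) θ) := by
      intro s
      induction s using Finset.cons_induction with
      | empty => simpa using concaveOn_const (0 : ℝ) convex_univ
      | cons i s hi ih =>
        simp only [Finset.sum_cons]
        exact (hconc (X i)).add ih
    exact this _
  exact (hsum.add h3.logConcave).smul hγ.le

theorem IsLocallyStronglyConcaveSmooth.logPosterior_sub_le (hn : 0 < n) (hγ : 0 < γ)
    (h1 : IsLocallyStronglyConcaveSmooth p θs m L) (h3 : IsRegularPrior π₀ L)
    (X : Fin n → ℝ) (θ : EuclideanSpace ℝ (Fin d)) :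
    γ * ((n : ℝ) * avgLogLikelihood p X θ + Real.log (π₀ θ)) -
        γ * ((n : ℝ) * avgLogLikelihood p X θs + Real.log (π₀ θs)) ≤
      γ * (‖totalScore p θs X‖ * ‖θ - θs‖ - n * (m / 2) * ‖θ - θs‖ ^ 2 +
        Real.log (priorQuality π₀ θs)) := by
  rw [natCast_mul_avgLogLikelihood hn, natCast_mul_avgLogLikelihood hn, ← mul_sub]
  refine mul_le_mul_of_nonneg_left ?_ hγ.le
  have h := Finset.sum_le_sum fun i (_ : i ∈ Finset.univ) => h1.lower (X i) θ
  simp only [Finset.sum_add_distrib, Finset.sum_sub_distrib, Finset.sum_neg_distrib,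
    ← sum_inner, Finset.sum_const, Finset.card_univ, Fintype.card_fin, nsmul_eq_mul] at h
  have hcs := real_inner_le_norm (totalScore p θs X) (θ - θs)
  rw [totalScore] at hcs ⊢
  have hπ := h3.log_sub_log_le θ θs
  linarith

theorem scaledPosteriorWeight_univ_ne_top (hn : 0 < n) (hγ : 0 < γ) (hm : 0 < m)
    (h1 : IsLocallyStronglyConcaveSmooth p θs m L) (h3 : IsRegularPrior π₀ L) (X : Fin n → ℝ) :
    scaledPosteriorWeight p π₀ γ X Set.univ ≠ ⊤ := by
  have hn' : (0 : ℝ) < n := by exact_mod_cast hn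
  rw [scaledPosteriorWeight, withDensity_apply _ MeasurableSet.univ, Measure.restrict_univ]
  refine (lintegral_exp_lt_top_of_le_quadratic θs
    (K := γ * ((n : ℝ) * avgLogLikelihood p X θs + Real.log (π₀ θs)) +
      γ * Real.log (priorQuality π₀ θs))
    (b := γ * ‖totalScore p θs X‖) (q := γ * (n * (m / 2))) (by positivity) fun θ => ?_).ne
  have h := h1.logPosterior_sub_le hn hγ h3 X θ
  linarith

theorem scaledPosteriorWeight_univ_ne_zero (hn : 0 < n) (hγ : 0 < γ)
    (hconc : IsLogConcaveFamily p) (h3 : IsRegularPrior π₀ L) (X : Fin n → ℝ) :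
    scaledPosteriorWeight p π₀ γ X Set.univ ≠ 0 := by
  have hU := (continuousOn_univ.1
    ((concaveOn_logPosterior hn hγ hconc h3 X).continuousOn isOpen_univ)).measurable
  rw [scaledPosteriorWeight, withDensity_apply _ MeasurableSet.univ, Measure.restrict_univ]
  rw [Ne, lintegral_eq_zero_iff (by fun_prop)]
  intro h
  obtain ⟨θ, hθ⟩ := h.exists
  simp only [Pi.zero_apply, ENNReal.ofReal_eq_zero] at hθ
  exact absurd (Real.exp_pos _) (not_lt.2 hθ)

theorem isProbabilityMeasure_scaledPosterior (hn : 0 < n) (hγ : 0 < γ) (hm : 0 < m)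
    (hconc : IsLogConcaveFamily p) (h1 : IsLocallyStronglyConcaveSmooth p θs m L)
    (h3 : IsRegularPrior π₀ L) (X : Fin n → ℝ) :
    IsProbabilityMeasure (scaledPosterior p π₀ γ X) :=
  ⟨by
    rw [scaledPosterior, Measure.smul_apply, smul_eq_mul]
    exact ENNReal.inv_mul_cancel (scaledPosteriorWeight_univ_ne_zero hn hγ hconc h3 X)
      (scaledPosteriorWeight_univ_ne_top hn hγ hm h1 h3 X)⟩

theorem scaledPosterior_le_of_logPosterior_sub_le (hn : 0 < n) (hγ : 0 < γ) (hm : 0 < m)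
    (hconc : IsLogConcaveFamily p) (h1 : IsLocallyStronglyConcaveSmooth p θs m L)
    (h3 : IsRegularPrior π₀ L) (X : Fin n → ℝ) {s a : ℝ} (hs : 0 ≤ s) (hs1 : s < 1)
    {A : Set (EuclideanSpace ℝ (Fin d))} (hA : MeasurableSet A)
    (h : ∀ θ ∈ A, γ * ((n : ℝ) * avgLogLikelihood p X θ + Real.log (π₀ θ)) -
        γ * ((n : ℝ) * avgLogLikelihood p X θs + Real.log (π₀ θs)) ≤ -a) :
    scaledPosterior p π₀ γ X A ≤
      ENNReal.ofReal (((1 - s) ^ d)⁻¹ * Real.exp (-(s * a))) := by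
  have hw := withDensity_exp_le_of_concaveOn volume
    (concaveOn_logPosterior hn hγ hconc h3 X) θs hs hs1 hA h
  rw [finrank_euclideanSpace_fin] at hw
  rw [scaledPosterior, Measure.smul_apply, smul_eq_mul]
  refine (mul_le_mul_right hw _).trans_eq ?_
  rw [mul_left_comm]
  refine (congrArg _ (ENNReal.inv_mul_cancel
    (scaledPosteriorWeight_univ_ne_zero hn hγ hconc h3 X)
    (scaledPosteriorWeight_univ_ne_top hn hγ hm h1 h3 X))).trans (mul_one _)

/-- Half of the curvature term `n m r² / 2` is spent on `S r` by Young's inequality, leaving `S² /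
(n m)`. Half of the bound defining the radius covers the rest: its `8 d κ²` term cancels the noise,
`log B` is absorbed since `e / 2 > 1`, and the `1 / γ` terms give the margin. -/
theorem le_quadratic_sub_of_contractionRadius_lt {B κ δ S r : ℝ} (hn : 0 < n) (hγ : 0 < γ)
    (hm : 0 < m) (hB : 1 ≤ B) (hδ : 0 ≤ Real.log (1 / δ))
    (hκ : L ≤ m * κ ^ 2)
    (hS : S ^ 2 ≤ 4 * (Real.exp 1 * Real.log (1 / δ)) * d * n * L)
    (hr : contractionRadius d n m γ B κ δ < r) :
    Real.exp 1 / 2 * (d + 32 * Real.log (1 / δ)) ≤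
      -(γ * (S * r - n * (m / 2) * r ^ 2 + Real.log B)) := by
  have hn' : (0 : ℝ) < n := by exact_mod_cast hn
  have hlB : 0 ≤ Real.log B := Real.log_nonneg hB
  set ℓ := Real.log (1 / δ)
  set e := Real.exp 1
  have he : 2 < e := by have := Real.exp_one_gt_d9; linarith
  have hr0 : 0 ≤ r := (Real.sqrt_nonneg _).trans hr.le
  rw [contractionRadius, Real.sqrt_lt' (lt_of_le_of_lt (Real.sqrt_nonneg _) hr)] at hr
  have hM : e * (d / γ + Real.log B + (32 / γ + 8 * d * κ ^ 2) * ℓ) ≤ n * m / 2 * r ^ 2 := by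
    have h := mul_le_mul_of_nonneg_left hr.le (show 0 ≤ (n : ℝ) * m / 2 by positivity)
    refine le_trans (le_of_eq ?_) h
    field_simp
    rfl
  have hSr : S * r ≤ n * m / 4 * r ^ 2 + S ^ 2 / (n * m) := by
    have h : n * m / 4 * r ^ 2 + S ^ 2 / (n * m) - S * r = (n * m * r / 2 - S) ^ 2 / (n * m) := by
      field_simp; ring
    have h' : 0 ≤ (n * m * r / 2 - S) ^ 2 / (n * m) := by positivity
    linarith
  have hSn : S ^ 2 / (n * m) ≤ 4 * (e * ℓ) * d * κ ^ 2 := by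
    rw [div_le_iff₀ (by positivity)]
    refine hS.trans ?_
    have h := mul_le_mul_of_nonneg_left hκ (show 0 ≤ 4 * (e * ℓ) * d * n by positivity)
    linarith
  have hlow : e / 2 * (d / γ + 32 / γ * ℓ) ≤
      -(S * r - n * (m / 2) * r ^ 2 + Real.log B) := by
    have : 0 ≤ (e / 2 - 1) * Real.log B := mul_nonneg (by linarith) hlB
    linarith
  have h := mul_le_mul_of_nonneg_left hlow hγ.le
  have h' : γ * (e / 2 * (d / γ + 32 / γ * ℓ)) = e / 2 * (d + 32 * ℓ) := by
    field_simp
  linarith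

theorem scaledPosterior_contractionRadius_lt_le {κ δ : ℝ} (hn : 0 < n) (hγ : 0 < γ) (hm : 0 < m)
    (hconc : IsLogConcaveFamily p) (h1 : IsLocallyStronglyConcaveSmooth p θs m L)
    (h3 : IsRegularPrior π₀ L) (hδ : 0 ≤ Real.log (1 / δ)) (hκ : L ≤ m * κ ^ 2)
    {X : Fin n → ℝ} (hX : ‖totalScore p θs X‖ ^ 2 ≤
      4 * (Real.exp 1 * Real.log (1 / δ)) * d * n * L) :
    scaledPosterior p π₀ γ X
        {θ | contractionRadius d n m γ (priorQuality π₀ θs) κ δ < ‖θ - θs‖} ≤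
      ENNReal.ofReal (Real.exp (-(10 * Real.log (1 / δ)))) := by
  have hA : MeasurableSet
      {θ | contractionRadius d n m γ (priorQuality π₀ θs) κ δ < ‖θ - θs‖} :=
    measurableSet_lt measurable_const (by fun_prop)
  -- With `s = 1/4` the gain is `s a = (e / 8) d + 4 e log (1/δ)`: `e / 8 > 1/3` beats the volume
  -- factor `(4/3)ᵈ ≤ exp (d / 3)`, and `4 e > 10`.
  refine (scaledPosterior_le_of_logPosterior_sub_le hn hγ hm hconc h1 h3 X (s := 1 / 4)
    (a := Real.exp 1 / 2 * (d + 32 * Real.log (1 / δ))) (by norm_num) (by norm_num) hA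
    fun θ hθ => ?_).trans (ENNReal.ofReal_le_ofReal ?_)
  · have h := le_quadratic_sub_of_contractionRadius_lt hn hγ hm (h3.one_le_priorQuality θs) hδ hκ
      hX hθ
    have h' := h1.logPosterior_sub_le hn hγ h3 X θ
    linarith
  · have he := Real.exp_one_gt_d9
    have hd : (0 : ℝ) ≤ d := d.cast_nonneg
    have hpow : ((1 - 1 / 4 : ℝ) ^ d)⁻¹ ≤ Real.exp (d * (1 / 3)) := by
      rw [Real.exp_nat_mul, ← inv_pow]
      refine pow_le_pow_left₀ (by norm_num) ?_ d
      have := Real.add_one_le_exp (1 / 3 : ℝ)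
      norm_num at this ⊢
      linarith
    refine (mul_le_mul_of_nonneg_right hpow (Real.exp_pos _).le).trans ?_
    rw [← Real.exp_add]
    refine Real.exp_le_exp.2 ?_
    nlinarith [mul_le_mul_of_nonneg_right he.le hd, mul_le_mul_of_nonneg_right he.le hδ]

end Posterior

/-! ### Combining the two failure probabilities -/

/-- Relative to `exp (-ℓ)`, the first term is at most `exp (-1/4) ≤ 4/5` and the second at most `exp
(-4) < 1/5`; both use `ℓ ≥ 1/2`, which is where `δ ≤ exp (-1/2)` enters. -/
theorem sqrt_two_mul_exp_add_exp_lt {ℓ : ℝ} (hℓ : 1 / 2 ≤ ℓ) :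
    √2 * Real.exp (-(Real.exp 1 * ℓ)) + Real.exp (-(10 * ℓ)) < Real.exp (-ℓ) := by
  have he := Real.exp_one_gt_d9
  have h2 : √2 ≤ Real.exp (1 / 2) := by
    have h := Real.add_one_le_exp (1 / 2 : ℝ)
    have h' : √2 ≤ 3 / 2 := by
      rw [Real.sqrt_le_left (by norm_num)]; norm_num
    linarith
  have ha : √2 * Real.exp (-(Real.exp 1 * ℓ)) ≤ Real.exp (-ℓ) * Real.exp (-(1 / 4)) := by
    refine (mul_le_mul_of_nonneg_right h2 (Real.exp_pos _).le).trans ?_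
    rw [← Real.exp_add, ← Real.exp_add]
    refine Real.exp_le_exp.2 ?_
    nlinarith
  have hb : Real.exp (-(10 * ℓ)) ≤ Real.exp (-ℓ) * Real.exp (-4) := by
    rw [← Real.exp_add]
    exact Real.exp_le_exp.2 (by linarith)
  have hc : Real.exp (-(1 / 4)) ≤ 4 / 5 := by
    rw [Real.exp_neg, inv_le_comm₀ (Real.exp_pos _) (by norm_num)]
    have h := Real.add_one_le_exp (1 / 4 : ℝ)
    norm_num at h ⊢
    linarith
  have hd : Real.exp (-4) < 1 / 5 := by
    rw [Real.exp_neg, inv_lt_comm₀ (Real.exp_pos _) (by norm_num)]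
    have h := Real.add_one_lt_exp (show (4 : ℝ) ≠ 0 by norm_num)
    norm_num at h ⊢
    linarith
  nlinarith [Real.exp_pos (-ℓ)]

theorem lintegral_le_measure_compl_add {α : Type*} [MeasurableSpace α]
    (P : Measure α) [IsProbabilityMeasure P] {f : α → ENNReal} {G : Set α} (hG : MeasurableSet G)
    {ε : ENNReal} (hf : ∀ x, f x ≤ 1) (hfG : ∀ x ∈ G, f x ≤ ε) :
    ∫⁻ x, f x ∂P ≤ P Gᶜ + ε := by
  rw [← lintegral_add_compl f hG, add_comm]
  refine add_le_add ((setLIntegral_mono' hG.compl fun x _ => hf x).trans_eq ?_)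
    ((setLIntegral_mono' hG hfG).trans ?_)
  · simp
  · rw [setLIntegral_const]
    exact mul_le_of_le_one_right' prob_le_one

theorem theorem1 (d n : ℕ) (hn : 0 < n)
    (p : ℝ → EuclideanSpace ℝ (Fin d) → ℝ) (π₀ : EuclideanSpace ℝ (Fin d) → ℝ)
    (θs : EuclideanSpace ℝ (Fin d)) (m L ν γ : ℝ)
    (hm : 0 < m) (hL : 0 < L) (hν : 0 < ν) (hγ : 0 < γ)
    (hp : IsRewardFamily p) (hconc : IsLogConcaveFamily p)
    (h1 : IsLocallyStronglyConcaveSmooth p θs m L)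
    (h2 : IsRegularReward p θs ν L)
    (h3 : IsRegularPrior π₀ L) :
    -- the maximum in the definition of `B` exists
    (∃ θ₀, ∀ θ, π₀ θ ≤ π₀ θ₀) ∧
    -- the scaled posterior is well defined, for every data set
    (∀ X : Fin n → ℝ, IsProbabilityMeasure (scaledPosterior p π₀ γ X)) ∧
    ∀ δ : ℝ, 0 < δ → δ ≤ Real.exp (-(1 / 2)) →
      -- for data and parameter drawn jointly
      ∫⁻ X, scaledPosterior p π₀ γ X
          {θ | contractionRadius d n m γ (priorQuality π₀ θs) (conditionNumber m ν L) δ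
            < ‖θ - θs‖} ∂(dataLaw p θs n) < ENNReal.ofReal δ ∧
      -- with high probability over the data
      ENNReal.ofReal (1 - δ) ≤ dataLaw p θs n
        {X | scaledPosterior p π₀ γ X
          {θ | contractionRadius d n m γ (priorQuality π₀ θs) (conditionNumber m ν L) δ
            < ‖θ - θs‖} < ENNReal.ofReal δ} := by
  refine ⟨h3.exists_max, isProbabilityMeasure_scaledPosterior hn hγ hm hconc h1 h3,
    fun δ hδ hδ1 => ?_⟩
  have hprob := isProbabilityMeasure_scaledPosterior hn hγ hm hconc h1 h3
  have hdata := hp.isProbabilityMeasure_dataLaw (θs := θs) n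
  -- In dimension zero the parameter space is a point, and neither `m ≤ L` nor the average over
  -- coordinates is available.
  rcases Nat.eq_zero_or_pos d with rfl | hd
  · have hempty : {θ | contractionRadius 0 n m γ (priorQuality π₀ θs) (conditionNumber m ν L) δ
        < ‖θ - θs‖} = ∅ := by
      refine Set.eq_empty_of_forall_notMem fun θ hθ => ?_
      rw [Set.mem_ofPred_eq, Subsingleton.elim θ θs, sub_self, norm_zero] at hθ
      exact absurd hθ (not_lt.2 (Real.sqrt_nonneg _))
    rw [hempty]
    refine ⟨by simpa using hδ, ?_⟩
    simp [hδ, hδ.le]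
  have : NeZero d := ⟨hd.ne'⟩
  have hℓ : Real.log (1 / δ) = -Real.log δ := by rw [one_div, Real.log_inv]
  have hℓ2 : 1 / 2 ≤ Real.log (1 / δ) := by
    have h := (Real.log_le_iff_le_exp hδ).2 hδ1
    linarith
  have hδe : Real.exp (-Real.log (1 / δ)) = δ := by rw [hℓ, neg_neg, Real.exp_log hδ]
  -- `L ≤ m κ ≤ m κ²`, the last step because `m ≤ L` forces `κ ≥ 1`.
  have hκ : L ≤ m * conditionNumber m ν L ^ 2 := by
    have hκ1 : L / m ≤ conditionNumber m ν L := le_max_left _ _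
    have hκ2 : 1 ≤ conditionNumber m ν L := le_trans ((one_le_div hm).2 h1.le) hκ1
    rw [div_le_iff₀ hm] at hκ1
    nlinarith [mul_le_mul_of_nonneg_left hκ2 (mul_pos hm (one_pos.trans_le hκ2)).le]
  set G : Set (Fin n → ℝ) := {X | ‖totalScore p θs X‖ ^ 2 ≤
    4 * (Real.exp 1 * Real.log (1 / δ)) * d * n * L} with hGdef
  have hG : MeasurableSet G := by
    have hS := h2.continuous_totalScore n
    exact (isClosed_le (by fun_prop) continuous_const).measurableSet
  have hbad : dataLaw p θs n Gᶜ ≤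
      ENNReal.ofReal (√2 * Real.exp (-(Real.exp 1 * Real.log (1 / δ)))) := by
    have h := h1.dataLaw_lt_norm_totalScore_le h2 hp hL hn (Real.exp 1 * Real.log (1 / δ))
    have hGc : Gᶜ = {X | 4 * (Real.exp 1 * Real.log (1 / δ)) * d * n * L
        < ‖totalScore p θs X‖ ^ 2} := by
      ext X; simp [hGdef]
    rwa [hGc]
  have hgood : ∀ X ∈ G, scaledPosterior p π₀ γ X
      {θ | contractionRadius d n m γ (priorQuality π₀ θs) (conditionNumber m ν L) δ
        < ‖θ - θs‖} ≤ ENNReal.ofReal (Real.exp (-(10 * Real.log (1 / δ)))) := fun X hX =>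
    scaledPosterior_contractionRadius_lt_le hn hγ hm hconc h1 h3 (by linarith) hκ hX
  have hlt := sqrt_two_mul_exp_add_exp_lt hℓ2
  rw [hδe] at hlt
  have hpos1 : 0 < √2 * Real.exp (-(Real.exp 1 * Real.log (1 / δ))) := by positivity
  have hpos2 : 0 < Real.exp (-(10 * Real.log (1 / δ))) := Real.exp_pos _
  constructor
  · refine (lintegral_le_measure_compl_add (dataLaw p θs n) hG
      (fun X => prob_le_one) hgood).trans_lt ?_
    refine (add_le_add hbad le_rfl).trans_lt ?_
    rw [← ENNReal.ofReal_add hpos1.le hpos2.le]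
    exact (ENNReal.ofReal_lt_ofReal_iff hδ).2 hlt
  · have hsub : G ⊆ {X | scaledPosterior p π₀ γ X
          {θ | contractionRadius d n m γ (priorQuality π₀ θs) (conditionNumber m ν L) δ
            < ‖θ - θs‖} < ENNReal.ofReal δ} := fun X hX =>
      (hgood X hX).trans_lt ((ENNReal.ofReal_lt_ofReal_iff hδ).2 (by linarith))
    refine le_trans ?_ (measure_mono hsub)
    rw [ENNReal.ofReal_sub _ hδ.le, ENNReal.ofReal_one, tsub_le_iff_right,
      ← prob_add_prob_compl (μ := dataLaw p θs n) hG]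
    gcongr
    exact hbad.trans (ENNReal.ofReal_le_ofReal (by linarith))
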